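/- Let $A$ and $B$ be finite-dimensional quantum systems with fixed orthonormal bases, let $G$ be a compact group, and let $g\mapsto \mathcal U^g_A=U^g_A(\cdot)U^{g\dagger}_A$ and $g\mapsto \mathcal U^g_B=U^g_B(\cdot)U_B^{g\dagger}$ be continuous representations of $G$ by unitary channels on $A$ and $B$. A channel (completely positive trace-preserving linear map) $\mathcal E$ from $A$ to $B$ is $G$-covariant if $\mathcal E\circ\mathcal U_A^g=\mathcal U_B^g\circ\mathcal E$ for all $g\in G$. Let $\Lambda$ be a non-empty compact space, and for $\mu\in\Lambda$ let $\rho_\mu$ be a quantum state of $A$ and $\psi_\mu$ a pure state of $B$, both depending Borel measurably on $\mu$. For a Borel probability measure $p$ on $\Lambda$ put $$\Sigma^p_{BA}=\int_G dg\,(\overline{U^g_B}\otimes U^g_A)\Big(\int_\Lambda dp(\mu)\,\psi_\mu^T\otimes\rho_\mu\Big)(\overline{U^g_B}\otimes U^g_A)^\dagger ,$$ where $dg$ is the Haar probability measure and transpose and complex conjugate are taken in the fixed basis. Let $$H_{\min}(B|A)_\Sigma=-\log_2\inf\{\operatorname{tr}X : X\ge 0 \text{ on } A,\ \mathbb 1_B\otimes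 X-\Sigma_{BA}\ge 0\},\qquad F(\rho,\sigma)=\Big(\operatorname{tr}\sqrt{\sqrt\rho\,\sigma\sqrt\rho}\Big)^2 .$$ Then for every $0\le\varepsilon\le 1$ there is a single $G$-covariant channel $\mathcal E$ from $A$ to $B$ with $F(\mathcal E(\rho_\mu),\psi_\mu)\ge 1-\varepsilon$ for all $\mu\in\Lambda$ if and only if $$\sup_p H_{\min}(B|A)_{\Sigma^p_{BA}}\le\log_2\frac1{1-\varepsilon},$$ the supremum being over all Borel probability measures $p$ on $\Lambda$, with $\log_2\frac10=+\infty$. If moreover $\mu\mapsto\rho_\mu$ and $\mu\mapsto\psi_\mu$ are continuous, the supremum is attained, that is, it is a maximum. -/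

import Mathlib

open Matrix MeasureTheory
open scoped ComplexOrder MatrixOrder Kronecker ENNReal

noncomputable section

namespace Asymmetry

variable {G Λ a b n : Type*}

/-! ### States, channels, fidelity on finite-dimensional systems -/

/-- Quantum states on `ℂⁿ`: positive semidefinite matrices of trace one. -/
def IsState [Fintype n] (ρ : Matrix n n ℂ) : Prop :=
  ρ.PosSemidef ∧ ρ.trace = 1

/-- Pure states on `ℂⁿ`: the rank-one projections `|v⟩⟨v|` on unit vectors `v`. -/
def IsPureState [Fintype n] (ψ : Matrix n n ℂ) : Prop :=
  ∃ v : n → ℂ, star v ⬝ᵥ v = 1 ∧ ψ = vecMulVec v (star v)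

/-- The (squared) fidelity `F(ρ, σ) = (tr √(√ρ σ √ρ))²`. -/
def fidelity [Fintype n] [DecidableEq n] (ρ σ : Matrix n n ℂ) : ℝ :=
  ((CFC.sqrt (CFC.sqrt ρ * σ * CFC.sqrt ρ)).trace.re) ^ 2

/-- The map `id_k ⊗ E`, which applies `E` to every block of a `k × k` block matrix. -/
def ampliation (E : Matrix a a ℂ →ₗ[ℂ] Matrix b b ℂ) (k : ℕ)
    (M : Matrix (Fin k × a) (Fin k × a) ℂ) : Matrix (Fin k × b) (Fin k × b) ℂ :=
  Matrix.of fun x y => E (Matrix.of fun i j => M (x.1, i) (y.1, j)) x.2 y.2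

/-- Complete positivity: every ampliation `id_k ⊗ E` preserves positive semidefiniteness. -/
def IsCompletelyPositive (E : Matrix a a ℂ →ₗ[ℂ] Matrix b b ℂ) : Prop :=
  ∀ (k : ℕ) (M : Matrix (Fin k × a) (Fin k × a) ℂ), M.PosSemidef → (ampliation E k M).PosSemidef

/-- Quantum channels: completely positive and trace-preserving linear maps. -/
structure IsChannel [Fintype a] [Fintype b] (E : Matrix a a ℂ →ₗ[ℂ] Matrix b b ℂ) : Prop where
  completelyPositive : IsCompletelyPositive E
  tracePreserving : ∀ X, (E X).trace = X.trace

/-! ### Group actions and covariance -/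

/-- The unitary channel `X ↦ U X U†`. -/
def unitaryChannel [Fintype n] [DecidableEq n] (U : unitaryGroup n ℂ) :
    Matrix n n ℂ →ₗ[ℂ] Matrix n n ℂ :=
  LinearMap.mulLeftRight ℂ ((U : Matrix n n ℂ), (U : Matrix n n ℂ)ᴴ)

/-- `g ↦ 𝒰_g = U_g (·) U_g†` is a continuous representation of `G` by unitary channels. This is the
case for every continuous unitary representation `U`, and also if `U` is a representation only up
to phases. -/
structure IsAdjointUnitaryRep [Group G] [TopologicalSpace G] [Fintype n] [DecidableEq n]
    (U : G → unitaryGroup n ℂ) : Prop where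
  map_mul : ∀ g h, unitaryChannel (U (g * h)) = unitaryChannel (U g) ∘ₗ unitaryChannel (U h)
  continuous : ∀ X, Continuous fun g => unitaryChannel (U g) X

/-- `E` is `G`-covariant: `E ∘ 𝒰^A_g = 𝒰^B_g ∘ E` for all `g`. -/
def IsCovariant [Fintype a] [DecidableEq a] [Fintype b] [DecidableEq b]
    (UA : G → unitaryGroup a ℂ) (UB : G → unitaryGroup b ℂ)
    (E : Matrix a a ℂ →ₗ[ℂ] Matrix b b ℂ) : Prop :=
  ∀ g, E ∘ₗ unitaryChannel (UA g) = unitaryChannel (UB g) ∘ₗ E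

/-- The Haar probability measure of a compact group. -/
def haarProb (G : Type*) [Group G] [TopologicalSpace G] [IsTopologicalGroup G] [CompactSpace G]
    [MeasurableSpace G] [BorelSpace G] : Measure G :=
  Measure.haarMeasure (⊤ : TopologicalSpace.PositiveCompacts G)

/-- The global `G`-twirl `Π^G(X) = ∫ dg (Ū^B_g ⊗ U^A_g) X (Ū^B_g ⊗ U^A_g)†` on the system `BA`,
with `Ū` the entrywise complex conjugate of `U`; the integral is taken entrywise. -/
def twirl [Group G] [TopologicalSpace G] [IsTopologicalGroup G] [CompactSpace G]
    [MeasurableSpace G] [BorelSpace G] [Fintype a] [DecidableEq a] [Fintype b] [DecidableEq b]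
    (UB : G → unitaryGroup b ℂ) (UA : G → unitaryGroup a ℂ)
    (X : Matrix (b × a) (b × a) ℂ) : Matrix (b × a) (b × a) ℂ :=
  Matrix.of fun i j => ∫ g,
    ((((UB g : Matrix b b ℂ).map star) ⊗ₖ (UA g : Matrix a a ℂ)) * X *
      (((UB g : Matrix b b ℂ).map star) ⊗ₖ (UA g : Matrix a a ℂ))ᴴ) i j ∂(haarProb G)

/-! ### Conditional min-entropy -/

/-- The logarithm to base `2` with values in `[-∞, ∞]`; `log₂ 0 = -∞` and `log₂ ∞ = ∞`. -/
def log2 (x : ℝ≥0∞) : EReal := ENNReal.log x / ENNReal.log 2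

/-- `H_min(B|A)_Σ = - log₂ inf {tr X | X ≥ 0 on A, 1_B ⊗ X - Σ ≥ 0}`. -/
def condMinEntropy [DecidableEq b] [Fintype a] (S : Matrix (b × a) (b × a) ℂ) : EReal :=
  - log2 (⨅ X ∈ {X : Matrix a a ℂ | X.PosSemidef ∧ ((1 : Matrix b b ℂ) ⊗ₖ X - S).PosSemidef},
      ENNReal.ofReal X.trace.re)

/-- The averaged operator `∫ dp(μ) ψ_μᵀ ⊗ ρ_μ` on `BA`; the integral is taken entrywise. -/
def averagedState [MeasurableSpace Λ] (p : ProbabilityMeasure Λ) (ψ : Λ → Matrix b b ℂ)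
    (ρ : Λ → Matrix a a ℂ) : Matrix (b × a) (b × a) ℂ :=
  Matrix.of fun i j => ∫ μ, ((ψ μ)ᵀ ⊗ₖ ρ μ) i j ∂(p : Measure Λ)

/-- The operator `Σ^p = Π^G(∫ dp(μ) ψ_μᵀ ⊗ ρ_μ)` on `BA`. -/
def sigmaState [Group G] [TopologicalSpace G] [IsTopologicalGroup G] [CompactSpace G]
    [MeasurableSpace G] [BorelSpace G] [Fintype a] [DecidableEq a] [Fintype b] [DecidableEq b]
    [MeasurableSpace Λ] (UB : G → unitaryGroup b ℂ) (UA : G → unitaryGroup a ℂ)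
    (ψ : Λ → Matrix b b ℂ) (ρ : Λ → Matrix a a ℂ) (p : ProbabilityMeasure Λ) :
    Matrix (b × a) (b × a) ℂ :=
  twirl UB UA (averagedState p ψ ρ)

end Asymmetry

end

noncomputable section

namespace Asymmetry

/-! ### Convexity -/

/-! A channel `E` corresponds to its Choi operator `J ≥ 0` through tr(Y E(X)) = tr((Yᵀ ⊗ X) J).
Trace preservation becomes tr_B J = 1, and covariance becomes invariance of `J` under Ū_B ⊗ U_A. For
pure ψ the fidelity is linear, F(E(ρ), ψ) = tr(ψ E(ρ)) = tr(T J), where T is the twirl of ψᵀ ⊗ ρ;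
the twirl costs nothing because `J` is invariant. On the other side, H_min ≤ log₂(1/c) says that
every `X` feasible for Σ^p has trace at least c.

Weak duality: a channel with all fidelities at least c satisfies c ≤ tr(Σ^p J) ≤ tr((1 ⊗ X) J) = tr
X (`le_trace_of_channel`).

For the converse, one application of Sion's minimax theorem gives both semidefinite duality and a
channel independent of p. The payoff is L(J, (S, X)) = tr(S J) + tr(X (1 - tr_B J)). Here `J` runs
over the compact convex set of invariant positive operators of trace dim A, S over the convex hull
of the T_μ, and `X` over all invariant hermitian operators. For fixed (S, X), the maximum m of L
over `J` bounds the largest eigenvalue of S - 1 ⊗ X, and shifting `X` by a multiple of 1 gives a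
feasible operator of trace m (`exists_feasible_of_lagrangian_le`); so m ≥ c. Minimax then yields one
`J` with L ≥ c throughout. As `X` ranges over a vector space, this forces tr_B J = 1
(`exists_invariant_choi`).

Attainment: for continuous families the hull of the T_μ is compact, contains every Σ^p and consists
of such operators, so tr X has a minimum over feasible pairs (S, X). -/

theorem sum_extend_zero {ι κ M : Type*} [Fintype ι] [Fintype κ] [AddCommMonoid M] {e : ι → κ}
    (he : e.Injective) (f : ι → M) : ∑ j, Function.extend e f 0 j = ∑ i, f i := by
  classical
  rw [← Finset.sum_subset (Finset.subset_univ (Finset.univ.map ⟨e, he⟩)), Finset.sum_map]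
  · exact Finset.sum_congr rfl fun i _ => he.extend_apply _ _ _
  · intro j _ hj
    rw [Function.extend_apply']
    · rfl
    · rintro ⟨i, rfl⟩
      exact hj (by simp)

/-- In a finite-dimensional space the convex hull of a compact set is compact. -/
theorem isCompact_convexHull {V : Type*} [AddCommGroup V] [Module ℝ V] [TopologicalSpace V]
    [IsTopologicalAddGroup V] [ContinuousSMul ℝ V] [FiniteDimensional ℝ V] {s : Set V}
    (hs : IsCompact s) : IsCompact (convexHull ℝ s) := by
  rcases s.eq_empty_or_nonempty with rfl | ⟨x₀, hx₀⟩
  · simp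
  -- Carathéodory: N points always suffice. Shorter combinations are padded with weight 0 at x₀, so
  -- the hull is the continuous image of a simplex times sᴺ.
  let N := Module.finrank ℝ V + 1
  have hc : IsCompact ((fun q : (Fin N → ℝ) × (Fin N → V) => ∑ i, q.1 i • q.2 i) ''
      (stdSimplex ℝ (Fin N) ×ˢ Set.univ.pi fun _ => s)) := by
    refine ((isCompact_stdSimplex ℝ (Fin N)).prod (isCompact_univ_pi fun _ => hs)).image ?_
    fun_prop
  convert hc using 1
  apply Set.Subset.antisymm
  · intro x hx
    obtain ⟨ι, _, z, w, hz, hai, hw, hw1, rfl⟩ := eq_pos_convex_span_of_mem_convexHull hx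
    have hcard : Fintype.card ι ≤ N := hai.card_le_finrank_succ.trans
      (Nat.add_le_add_right (Submodule.finrank_le _) 1)
    obtain ⟨e⟩ : Nonempty (ι ↪ Fin N) :=
      Function.Embedding.nonempty_of_card_le (by simpa using hcard)
    refine ⟨(Function.extend e w 0, Function.extend e z fun _ => x₀), ⟨⟨fun j => ?_, ?_⟩, ?_⟩, ?_⟩
    · by_cases h : ∃ i, e i = j
      · obtain ⟨i, rfl⟩ := h
        simpa [e.injective.extend_apply] using (hw i).le
      · simp [Function.extend_apply' _ _ _ h]
    · exact (sum_extend_zero e.injective w).trans hw1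
    · intro j _
      by_cases h : ∃ i, e i = j
      · obtain ⟨i, rfl⟩ := h
        simpa [e.injective.extend_apply] using hz ⟨i, rfl⟩
      · simpa [Function.extend_apply' _ _ _ h] using hx₀
    · rw [← sum_extend_zero e.injective]
      refine Finset.sum_congr rfl fun j _ => ?_
      by_cases h : ∃ i, e i = j
      · obtain ⟨i, rfl⟩ := h
        simp [e.injective.extend_apply]
      · simp [Function.extend_apply' _ _ _ h]
  · rintro _ ⟨⟨w, z⟩, ⟨⟨hw, hw1⟩, hz⟩, rfl⟩
    exact (convex_convexHull ℝ s).sum_mem (fun i _ => hw i) hw1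
      fun i _ => subset_convexHull ℝ s (hz i trivial)

/-- A minimax principle: if every `y` in a convex set has a response `x` of payoff at least `c` in a
compact convex set, then some `x` has payoff at least `c` against every `y`. -/
theorem exists_forall_le_of_forall_exists_le {V W : Type*}
    [AddCommGroup V] [Module ℝ V] [TopologicalSpace V] [IsTopologicalAddGroup V]
    [ContinuousSMul ℝ V] [AddCommGroup W] [Module ℝ W] [TopologicalSpace W]
    [IsTopologicalAddGroup W] [ContinuousSMul ℝ W] {D : Set V} {Q : Set W} (hDc : IsCompact D)
    (hD : Convex ℝ D) (hDne : D.Nonempty) (hQ : Convex ℝ Q) (f : V → W → ℝ) (c : ℝ)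
    (hcont₁ : ∀ y, Continuous fun x => f x y) (hcont₂ : ∀ x, Continuous (f x))
    (hconc : ∀ y ∈ Q, ConcaveOn ℝ D fun x => f x y) (hconv : ∀ x ∈ D, ConvexOn ℝ Q (f x))
    (h : ∀ y ∈ Q, ∃ x ∈ D, c ≤ f x y) : ∃ x ∈ D, ∀ y ∈ Q, c ≤ f x y := by
  by_contra! hcon
  have hcover : D ⊆ ⋃ y : Q, {x | f x y < c} := by
    intro x hx
    obtain ⟨y, hy, hlt⟩ := hcon x hx
    exact Set.mem_iUnion.2 ⟨⟨y, hy⟩, hlt⟩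
  obtain ⟨t, ht⟩ := hDc.elim_finite_subcover _
    (fun y : Q => isOpen_lt (hcont₁ y) continuous_const) hcover
  -- Finitely many y already beat every x. Sion's lemma, applied to -f, merges them into a single y
  -- that beats every x, against the hypothesis.
  obtain ⟨y, hy, hlt⟩ := Sion.exists_lt_iInf_of_lt_iInf_of_finite (X := D) (Y := Q)
    (f := fun x y => -f x y) (t := -c) hDne hDc
    (fun y _ => (hcont₁ y).neg.lowerSemicontinuous.lowerSemicontinuousOn _)
    (fun y hy => (hconc y hy).neg.quasiconvexOn) hQ
    (fun x _ => (hcont₂ x).neg.upperSemicontinuous.upperSemicontinuousOn _)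
    (fun x hx => (hconv x hx).neg.quasiconcaveOn) hD
    (s := Subtype.val '' (t : Set Q)) (t.finite_toSet.image _) (by rintro _ ⟨y, _, rfl⟩; exact y.2)
    (fun x hx => by
      obtain ⟨y, hy, hlt⟩ := Set.mem_iUnion₂.1 (ht hx)
      exact ⟨y, ⟨y, hy, rfl⟩, neg_lt_neg hlt⟩)
  obtain ⟨x, hx, hle⟩ := h y hy
  exact absurd (hlt x hx) (by simpa using hle)

/-! ### Positive semidefinite matrices -/

theorem isClosed_posSemidef {n : Type*} [Fintype n] : IsClosed {M : Matrix n n ℂ | M.PosSemidef} := by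
  simp only [posSemidef_iff_dotProduct_mulVec, Set.ofPred_and, Set.ofPred_forall]
  refine IsClosed.inter ?_ (isClosed_iInter fun x => ?_)
  · exact isClosed_eq (by fun_prop) continuous_id
  · exact isClosed_le continuous_const (by fun_prop)

theorem convex_posSemidef {n : Type*} : Convex ℝ {M : Matrix n n ℂ | M.PosSemidef} :=
  fun _ hM _ hN _ _ hs ht _ => (hM.smul hs).add (hN.smul ht)

section PosSemidef

variable {n : Type*} [Fintype n] [DecidableEq n]

theorem exists_eq_conjTranspose_mul_self {M : Matrix n n ℂ} (hM : M.PosSemidef) :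
    ∃ B : Matrix n n ℂ, M = Bᴴ * B :=
  CStarAlgebra.nonneg_iff_eq_star_mul_self.mp hM.nonneg

theorem trace_mul_re_nonneg {M N : Matrix n n ℂ} (hM : M.PosSemidef) (hN : N.PosSemidef) :
    0 ≤ (M * N).trace.re := by
  obtain ⟨B, rfl⟩ := exists_eq_conjTranspose_mul_self hN
  rw [← Matrix.mul_assoc, Matrix.trace_mul_comm, ← Matrix.mul_assoc]
  exact (Complex.nonneg_iff.1 (hM.mul_mul_conjTranspose_same B).trace_nonneg).1

/-- With M = Bᴴ B, the entry M i j is an inner product of two columns of B, hence at most (M i i + M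
j j) / 2, and each diagonal entry is at most the trace. -/
theorem norm_apply_le_trace {M : Matrix n n ℂ} (hM : M.PosSemidef) (i j : n) :
    ‖M i j‖ ≤ M.trace.re := by
  obtain ⟨B, hB⟩ := exists_eq_conjTranspose_mul_self hM
  have hdiag : ∀ i, (M i i).re = ∑ k, ‖B k i‖ ^ 2 := fun i => by
    simp [hB, Matrix.mul_apply, Complex.sq_norm, Complex.normSq_apply]
  have hle : ∀ i, (M i i).re ≤ M.trace.re := fun i => by
    rw [Matrix.trace, Complex.re_sum]
    exact Finset.single_le_sum (f := fun i => (M i i).re)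
      (fun k _ => (Complex.nonneg_iff.1 hM.diag_nonneg).1) (Finset.mem_univ i)
  have h1 : ‖M i j‖ ≤ ∑ k, ‖B k i‖ * ‖B k j‖ := by
    rw [hB, Matrix.mul_apply]
    refine (norm_sum_le _ _).trans (Finset.sum_le_sum fun k _ => ?_)
    simp
  have h2 : ∑ k, ‖B k i‖ * ‖B k j‖ ≤ ∑ k, (‖B k i‖ ^ 2 + ‖B k j‖ ^ 2) / 2 :=
    Finset.sum_le_sum fun k _ => by nlinarith [sq_nonneg (‖B k i‖ - ‖B k j‖)]
  rw [← Finset.sum_div, Finset.sum_add_distrib, ← hdiag, ← hdiag] at h2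
  linarith [hle i, hle j]

theorem isCompact_posSemidef_trace_le (R : ℝ) :
    IsCompact {M : Matrix n n ℂ | M.PosSemidef ∧ M.trace.re ≤ R} := by
  have hK : IsCompact (Set.univ.pi fun _ : n => Set.univ.pi fun _ : n =>
      Metric.closedBall (0 : ℂ) R) :=
    isCompact_univ_pi fun _ => isCompact_univ_pi fun _ => isCompact_closedBall _ _
  refine hK.of_isClosed_subset (isClosed_posSemidef.inter
    (isClosed_le (Complex.continuous_re.comp continuous_id.matrix_trace) continuous_const)) fun M hM i _ j _ => ?_
  simpa using (norm_apply_le_trace hM.1 i j).trans hM.2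

end PosSemidef

/-! ### Fidelity with a pure state -/

/-- √σ |v⟩⟨v| √σ = |w⟩⟨w| with w = √σ v. Its square root is |w⟩⟨w| / ‖w‖, of trace ‖w‖, and ‖w‖² =
⟨v, σ v⟩. For w = 0 the convention 0⁻¹ = 0 keeps the formula valid. -/
theorem fidelity_vecMulVec {n : Type*} [Fintype n] [DecidableEq n] {σ : Matrix n n ℂ}
    (hσ : σ.PosSemidef) (v : n → ℂ) :
    fidelity σ (vecMulVec v (star v)) = (vecMulVec v (star v) * σ).trace.re := by
  set R := CFC.sqrt σ with hR
  have hRR : R * R = σ := CFC.sqrt_mul_sqrt_self σ hσ.nonneg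
  have hRH : Rᴴ = R := (CFC.sqrt_nonneg σ).posSemidef.isHermitian
  set w := R *ᵥ v with hw
  have hws : star v ᵥ* R = star w := by rw [hw, star_mulVec, hRH]
  have hRw : R * vecMulVec v (star v) * R = vecMulVec w (star w) := by
    rw [mul_vecMulVec, vecMulVec_mul, hws]
  have htr : (vecMulVec v (star v) * σ).trace = star w ⬝ᵥ w := by
    rw [← hRR, ← Matrix.mul_assoc, Matrix.trace_mul_comm, ← Matrix.mul_assoc, hRw,
      trace_vecMulVec, dotProduct_comm]
  have hww : star w ⬝ᵥ w = (((∑ i, ‖w i‖ ^ 2 : ℝ)) : ℂ) := by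
    simp [dotProduct, Complex.normSq_eq_conj_mul_self, ← Complex.normSq_eq_norm_sq]
  set N : ℝ := ∑ i, ‖w i‖ ^ 2 with hN
  have hN0 : 0 ≤ N := Finset.sum_nonneg fun i _ => sq_nonneg _
  rw [fidelity, ← hR, hRw, htr, hww, Complex.ofReal_re]
  have hsq : CFC.sqrt (vecMulVec w (star w)) =
      (((Real.sqrt N)⁻¹ : ℝ) : ℂ) • vecMulVec w (star w) := by
    apply CFC.sqrt_unique
    · rw [Matrix.smul_mul, Matrix.mul_smul, vecMulVec_mul_vecMulVec, hww, smul_smul]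
      rcases hN0.eq_or_lt with h0 | h0
      · have hw0 : w = 0 := by
          have := hww
          rw [← h0, Complex.ofReal_zero] at this
          exact dotProduct_star_self_eq_zero.1 this
        simp [hw0]
      · ext i j
        simp only [Matrix.smul_apply, vecMulVec_apply, Pi.smul_apply, smul_eq_mul]
        have : ((Real.sqrt N)⁻¹ : ℝ) * ((Real.sqrt N)⁻¹ : ℝ) * N = 1 := by
          rw [← mul_inv, Real.mul_self_sqrt hN0, inv_mul_cancel₀ h0.ne']
        have hC : (((Real.sqrt N)⁻¹ : ℝ) : ℂ) * (((Real.sqrt N)⁻¹ : ℝ) : ℂ) * (N : ℂ) = 1 := by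
          exact_mod_cast this
        linear_combination (w i * star w j) * hC
    · exact ((posSemidef_vecMulVec_self_star w).smul
        (Complex.zero_le_real.2 (inv_nonneg.2 (Real.sqrt_nonneg N)))).nonneg
  rw [hsq, trace_smul, trace_vecMulVec, dotProduct_comm, hww, smul_eq_mul, ← Complex.ofReal_mul,
    Complex.ofReal_re, mul_pow, inv_pow, Real.sq_sqrt hN0]
  rcases hN0.eq_or_lt with h0 | h0
  · simp [← h0]
  · field_simp

/-! ### The min-entropy as an optimization problem -/

theorem log2_le_log2_iff {x y : ℝ≥0∞} : log2 x ≤ log2 y ↔ x ≤ y := by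
  have h2 : ENNReal.log 2 = ((Real.log 2 : ℝ) : EReal) := by
    simpa using ENNReal.log_ofReal_of_pos (x := 2) two_pos
  have hpos : (0 : EReal) < ENNReal.log 2 := by
    rw [h2]; exact_mod_cast Real.log_pos one_lt_two
  have htop : ENNReal.log 2 ≠ ⊤ := by rw [h2]; exact EReal.coe_ne_top _
  rw [log2, log2, EReal.div_le_iff_le_mul hpos htop, mul_comm, EReal.div_mul_cancel,
    ENNReal.log_le_log_iff]
  · rw [h2]; exact EReal.coe_ne_bot _
  · exact htop
  · exact hpos.ne'

theorem log2_one_div (x : ℝ≥0∞) : log2 (1 / x) = -log2 x := by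
  rw [log2, log2, one_div, ENNReal.log_inv, EReal.div_eq_inv_mul, EReal.div_eq_inv_mul, mul_neg]

section MinEntropy

variable {a b : Type*} [DecidableEq b] [Fintype a]

/-- `log2` is an order embedding, so the bound concerns the infimum itself and hence each feasible
`X`. For c ≤ 0 both sides hold: the right-hand logarithm is ∞ and traces are nonnegative. -/
theorem condMinEntropy_le_iff {S : Matrix (b × a) (b × a) ℂ} {c : ℝ} :
    condMinEntropy S ≤ log2 (1 / ENNReal.ofReal c) ↔
      ∀ X : Matrix a a ℂ, X.PosSemidef → ((1 : Matrix b b ℂ) ⊗ₖ X - S).PosSemidef →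
        c ≤ X.trace.re := by
  rw [log2_one_div, condMinEntropy, EReal.neg_le_neg_iff, log2_le_log2_iff, le_iInf₂_iff]
  refine forall_congr' fun X => ⟨fun h hX hS => ?_, fun h hX => ENNReal.ofReal_le_ofReal (h hX.1 hX.2)⟩
  exact (ENNReal.ofReal_le_ofReal_iff (Complex.nonneg_iff.1 hX.trace_nonneg).1).1 (h ⟨hX, hS⟩)

theorem condMinEntropy_mono {S T : Matrix (b × a) (b × a) ℂ}
    (h : ∀ X : Matrix a a ℂ, X.PosSemidef → ((1 : Matrix b b ℂ) ⊗ₖ X - S).PosSemidef →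
      ∃ Y : Matrix a a ℂ, Y.PosSemidef ∧ ((1 : Matrix b b ℂ) ⊗ₖ Y - T).PosSemidef ∧
        Y.trace.re ≤ X.trace.re) :
    condMinEntropy S ≤ condMinEntropy T := by
  rw [condMinEntropy, condMinEntropy, EReal.neg_le_neg_iff, log2_le_log2_iff]
  refine le_iInf₂ fun X hX => ?_
  obtain ⟨Y, hY, hT, hle⟩ := h X hX.1 hX.2
  exact (iInf₂_le Y ⟨hY, hT⟩).trans (ENNReal.ofReal_le_ofReal hle)

end MinEntropy

/-! ### Entrywise integrals of matrices -/

section EntryIntegral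

variable {Ω m n : Type*} [MeasurableSpace Ω]

/-- The integral of a matrix-valued function, taken entrywise. -/
def entryIntegral (ν : Measure Ω) (F : Ω → Matrix m n ℂ) : Matrix m n ℂ :=
  Matrix.of fun i j => ∫ ω, F ω i j ∂ν

variable [Fintype m] [Fintype n] [DecidableEq m] [DecidableEq n]

theorem linearMap_apply_eq_sum (φ : Matrix m n ℂ →ₗ[ℂ] ℂ) (M : Matrix m n ℂ) :
    φ M = ∑ i, ∑ j, M i j * φ (Matrix.single i j 1) := by
  conv_lhs => rw [Matrix.matrix_eq_sum_single M]
  simp only [map_sum]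
  refine Finset.sum_congr rfl fun i _ => Finset.sum_congr rfl fun j _ => ?_
  rw [← smul_eq_mul, ← map_smul, smul_single, smul_eq_mul, mul_one]

theorem linearMap_entryIntegral {ν : Measure Ω} {F : Ω → Matrix m n ℂ}
    (hF : ∀ i j, Integrable (fun ω => F ω i j) ν) (φ : Matrix m n ℂ →ₗ[ℂ] ℂ) :
    φ (entryIntegral ν F) = ∫ ω, φ (F ω) ∂ν := by
  rw [linearMap_apply_eq_sum φ,
    integral_congr_ae (ae_of_all ν fun ω => linearMap_apply_eq_sum φ (F ω))]
  rw [integral_finsetSum _ fun i _ => integrable_finsetSum _ fun j _ => (hF i j).mul_const _]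
  refine Finset.sum_congr rfl fun i _ => ?_
  rw [integral_finsetSum _ fun j _ => (hF i j).mul_const _]
  exact Finset.sum_congr rfl fun j _ => (integral_mul_const _ _).symm

/-- The trace pairing with a fixed matrix, as a linear functional. -/
def tracePairing (N : Matrix n m ℂ) : Matrix m n ℂ →ₗ[ℂ] ℂ where
  toFun M := (M * N).trace
  map_add' M M' := by rw [Matrix.add_mul, trace_add]
  map_smul' := by simp


end EntryIntegral

section EntryIntegralMem

variable {Ω m n : Type*} [MeasurableSpace Ω] [Fintype m] [Fintype n]

attribute [local instance] Matrix.normedAddCommGroup Matrix.normedSpace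

/-- A Bochner average over a probability measure stays in a closed convex set; the entrywise
integral is the Bochner integral. -/
theorem entryIntegral_mem {ν : Measure Ω} [IsProbabilityMeasure ν] {F : Ω → Matrix m n ℂ}
    (hF : ∀ i j, Integrable (fun ω => F ω i j) ν) {C : Set (Matrix m n ℂ)} (hC : Convex ℝ C)
    (hCc : IsClosed C) (hmem : ∀ ω, F ω ∈ C) : entryIntegral ν F ∈ C := by
  have hint : Integrable (fun ω i j => F ω i j) ν :=
    Integrable.of_eval fun i => Integrable.of_eval fun j => hF i j
  have := hC.integral_mem (μ := ν) (f := F) hCc (ae_of_all _ hmem) hint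
  convert this using 1
  ext i j
  have h1 := eval_integral (μ := ν) (f := fun ω i j => F ω i j)
    (fun i => Integrable.of_eval fun j => hF i j) i
  have h2 := eval_integral (μ := ν) (f := fun ω j => F ω i j) (fun j => hF i j) j
  rw [← h1] at h2
  exact h2.symm

end EntryIntegralMem

/-! ### The action on `BA` and its twirl -/

section Twirl

variable {G a b : Type*} [Fintype a] [DecidableEq a] [Fintype b] [DecidableEq b]

/-- The unitary `Ū_B ⊗ U_A`. -/
def jointUnitary (UB : G → unitaryGroup b ℂ) (UA : G → unitaryGroup a ℂ) (g : G) :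
    Matrix (b × a) (b × a) ℂ :=
  ((UB g : Matrix b b ℂ).map star) ⊗ₖ (UA g : Matrix a a ℂ)

/-- The unitary channel `X ↦ (Ū_B ⊗ U_A) X (Ū_B ⊗ U_A)†` on `BA`. -/
def jointChannel (UB : G → unitaryGroup b ℂ) (UA : G → unitaryGroup a ℂ) (g : G) :
    Matrix (b × a) (b × a) ℂ →ₗ[ℂ] Matrix (b × a) (b × a) ℂ :=
  LinearMap.mulLeftRight ℂ (jointUnitary UB UA g, (jointUnitary UB UA g)ᴴ)

variable {UB : G → unitaryGroup b ℂ} {UA : G → unitaryGroup a ℂ}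

theorem jointChannel_apply (g : G) (X : Matrix (b × a) (b × a) ℂ) :
    jointChannel UB UA g X = jointUnitary UB UA g * X * (jointUnitary UB UA g)ᴴ := by
  simp [jointChannel, LinearMap.mulLeftRight_apply]

theorem unitaryChannel_apply {n : Type*} [Fintype n] [DecidableEq n] (U : unitaryGroup n ℂ)
    (X : Matrix n n ℂ) : unitaryChannel U X = (U : Matrix n n ℂ) * X * (U : Matrix n n ℂ)ᴴ := by
  simp [unitaryChannel, LinearMap.mulLeftRight_apply]

theorem map_star_conjTranspose {n : Type*} (M : Matrix n n ℂ) : (M.map star)ᴴ = Mᵀ := by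
  ext i j; simp

theorem conjTranspose_mul_unitary {n : Type*} [Fintype n] [DecidableEq n] (U : unitaryGroup n ℂ) :
    (U : Matrix n n ℂ)ᴴ * (U : Matrix n n ℂ) = 1 :=
  Unitary.coe_star_mul_self U

theorem unitary_mul_conjTranspose {n : Type*} [Fintype n] [DecidableEq n] (U : unitaryGroup n ℂ) :
    (U : Matrix n n ℂ) * (U : Matrix n n ℂ)ᴴ = 1 :=
  Unitary.coe_mul_star_self U

/-- The conjugate on B is what makes this work: Ū Yᵀ Ū† = (U Y U†)ᵀ. The joint action thus depends
only on the two unitary channels, so phases of the unitaries do not matter for its multiplicativity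
or continuity. -/
theorem jointChannel_kronecker (g : G) (Y : Matrix b b ℂ) (X : Matrix a a ℂ) :
    jointChannel UB UA g (Yᵀ ⊗ₖ X) =
      (unitaryChannel (UB g) Y)ᵀ ⊗ₖ unitaryChannel (UA g) X := by
  have h : (UB g : Matrix b b ℂ).map star = ((UB g : Matrix b b ℂ)ᴴ)ᵀ := rfl
  rw [jointChannel_apply, jointUnitary, conjTranspose_kronecker, ← mul_kronecker_mul,
    ← mul_kronecker_mul, map_star_conjTranspose, h, ← transpose_mul, ← transpose_mul, unitaryChannel_apply,
    unitaryChannel_apply, Matrix.mul_assoc (UB g : Matrix b b ℂ)]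

theorem jointUnitary_conjTranspose_mul (g : G) :
    (jointUnitary UB UA g)ᴴ * jointUnitary UB UA g = 1 := by
  have h : (UB g : Matrix b b ℂ).map star = ((UB g : Matrix b b ℂ)ᴴ)ᵀ := rfl
  rw [jointUnitary, conjTranspose_kronecker, ← mul_kronecker_mul, map_star_conjTranspose, h, ← transpose_mul,
    conjTranspose_mul_unitary, conjTranspose_mul_unitary, transpose_one, one_kronecker_one]

/-- Linear maps on matrices of a bipartite system are determined by product matrices. -/
theorem linearMap_ext_kronecker {V : Type*} [AddCommGroup V] [Module ℂ V]
    {φ χ : Matrix (b × a) (b × a) ℂ →ₗ[ℂ] V}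
    (h : ∀ (Y : Matrix b b ℂ) (X : Matrix a a ℂ), φ (Yᵀ ⊗ₖ X) = χ (Yᵀ ⊗ₖ X)) : φ = χ := by
  refine Matrix.ext_linearMap ℂ fun i j => LinearMap.ext_ring ?_
  have := h (Matrix.single j.1 i.1 1) (Matrix.single i.2 j.2 1)
  rw [transpose_single, single_kronecker_single, one_mul] at this
  exact this

theorem trace_mul_ext {n : Type*} [Fintype n] {M N : Matrix n n ℂ}
    (h : ∀ X : Matrix n n ℂ, (X * M).trace = (X * N).trace) : M = N :=
  Matrix.ext_iff_trace_mul_left.2 h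

/-- Invariance of `J` may be moved to the other side of the trace pairing. -/
theorem trace_jointChannel_mul {g : G} {J : Matrix (b × a) (b × a) ℂ}
    (hJ : jointChannel UB UA g J = J) (X : Matrix (b × a) (b × a) ℂ) :
    (jointChannel UB UA g X * J).trace = (X * J).trace := by
  have hu := jointUnitary_conjTranspose_mul (UB := UB) (UA := UA) g
  conv_lhs => rw [← hJ]
  rw [jointChannel_apply, jointChannel_apply]
  set K := jointUnitary UB UA g
  calc (K * X * Kᴴ * (K * J * Kᴴ)).trace = (K * (X * (Kᴴ * K) * J * Kᴴ)).trace := by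
        simp only [Matrix.mul_assoc]
    _ = (X * J * (Kᴴ * K)).trace := by
        rw [Matrix.trace_mul_comm, hu, Matrix.mul_one, Matrix.mul_assoc, hu]
    _ = _ := by rw [hu, Matrix.mul_one]

variable [Group G] [TopologicalSpace G]

theorem jointChannel_mul (hUA : IsAdjointUnitaryRep UA) (hUB : IsAdjointUnitaryRep UB) (g h : G) :
    jointChannel UB UA (g * h) = jointChannel UB UA g ∘ₗ jointChannel UB UA h := by
  refine linearMap_ext_kronecker fun Y X => ?_
  simp [jointChannel_kronecker, hUA.map_mul, hUB.map_mul]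

theorem continuous_jointChannel (hUA : IsAdjointUnitaryRep UA) (hUB : IsAdjointUnitaryRep UB)
    (X : Matrix (b × a) (b × a) ℂ) : Continuous fun g => jointChannel UB UA g X := by
  rw [Matrix.matrix_eq_sum_single X]
  simp only [map_sum]
  refine continuous_finsetSum _ fun i _ => continuous_finsetSum _ fun j _ => ?_
  have : Matrix.single i j (X i j) =
      X i j • ((Matrix.single j.1 i.1 (1 : ℂ))ᵀ ⊗ₖ Matrix.single i.2 j.2 (1 : ℂ)) := by
    rw [transpose_single, single_kronecker_single, smul_single]; simp
  simp only [this, map_smul, jointChannel_kronecker]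
  refine Continuous.const_smul (M := ℂ) (continuous_matrix fun k l => ?_) _
  exact ((hUB.continuous _).matrix_elem _ _).mul ((hUA.continuous _).matrix_elem _ _)

variable [IsTopologicalGroup G] [CompactSpace G] [MeasurableSpace G] [BorelSpace G]

instance isProbabilityMeasure_haarProb : IsProbabilityMeasure (haarProb G) :=
  ⟨by simpa [haarProb] using Measure.haarMeasure_self (K₀ := (⊤ : TopologicalSpace.PositiveCompacts G))⟩

instance isMulLeftInvariant_haarProb : (haarProb G).IsMulLeftInvariant :=
  Measure.isMulLeftInvariant_haarMeasure _

theorem twirl_eq_entryIntegral (X : Matrix (b × a) (b × a) ℂ) :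
    twirl UB UA X = entryIntegral (haarProb G) fun g => jointChannel UB UA g X := by
  simp only [jointChannel_apply]
  rfl

theorem integrable_of_continuous {f : G → ℂ} (hf : Continuous f) : Integrable f (haarProb G) := by
  obtain ⟨C, hC⟩ := (isCompact_range hf.norm).bddAbove
  exact Integrable.of_bound hf.aestronglyMeasurable C (ae_of_all _ fun g => hC ⟨g, rfl⟩)

theorem integrable_jointChannel (hUA : IsAdjointUnitaryRep UA) (hUB : IsAdjointUnitaryRep UB)
    (X : Matrix (b × a) (b × a) ℂ) (i j : b × a) :
    Integrable (fun g => jointChannel UB UA g X i j) (haarProb G) :=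
  integrable_of_continuous ((continuous_jointChannel hUA hUB X).matrix_elem i j)

/-- The twirl as a linear map. -/
def twirlLinear (hUA : IsAdjointUnitaryRep UA) (hUB : IsAdjointUnitaryRep UB) :
    Matrix (b × a) (b × a) ℂ →ₗ[ℂ] Matrix (b × a) (b × a) ℂ where
  toFun := twirl UB UA
  map_add' X Y := by
    simp only [twirl_eq_entryIntegral]
    ext i j
    simpa [entryIntegral] using
      integral_add (integrable_jointChannel hUA hUB X i j) (integrable_jointChannel hUA hUB Y i j)
  map_smul' c X := by
    simp only [twirl_eq_entryIntegral]
    ext i j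
    simpa [entryIntegral] using integral_const_mul c fun g => jointChannel UB UA g X i j

/-- Only constancy of the pairing along the orbit of the given `X` is assumed, so the result also
applies to Choi operators of covariant channels tested on product operators. -/
theorem trace_twirl_mul (hUA : IsAdjointUnitaryRep UA) (hUB : IsAdjointUnitaryRep UB)
    {J : Matrix (b × a) (b × a) ℂ} {X : Matrix (b × a) (b × a) ℂ}
    (h : ∀ g, (jointChannel UB UA g X * J).trace = (X * J).trace) :
    (twirl UB UA X * J).trace = (X * J).trace := by
  have := linearMap_entryIntegral (integrable_jointChannel hUA hUB X) (tracePairing J)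
  rw [twirl_eq_entryIntegral]
  refine this.trans ?_
  simp only [tracePairing, LinearMap.coe_mk, AddHom.coe_mk, h]
  simp

theorem jointChannel_twirl (hUA : IsAdjointUnitaryRep UA) (hUB : IsAdjointUnitaryRep UB)
    (g : G) (X : Matrix (b × a) (b × a) ℂ) :
    jointChannel UB UA g (twirl UB UA X) = twirl UB UA X := by
  rw [twirl_eq_entryIntegral]
  ext i j
  refine (linearMap_entryIntegral (integrable_jointChannel hUA hUB X)
    (Matrix.entryLinearMap ℂ ℂ i j ∘ₗ jointChannel UB UA g)).trans ?_
  have h : ∀ h, (Matrix.entryLinearMap ℂ ℂ i j ∘ₗ jointChannel UB UA g)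
      (jointChannel UB UA h X) = jointChannel UB UA (g * h) X i j := fun h => by
    simp [jointChannel_mul hUA hUB]
  simp only [h]
  -- Left invariance of the Haar measure.
  exact integral_mul_left_eq_self (fun h => jointChannel UB UA h X i j) g

theorem posSemidef_twirl (hUA : IsAdjointUnitaryRep UA) (hUB : IsAdjointUnitaryRep UB)
    {X : Matrix (b × a) (b × a) ℂ} (hX : X.PosSemidef) : (twirl UB UA X).PosSemidef := by
  rw [twirl_eq_entryIntegral]
  refine entryIntegral_mem (integrable_jointChannel hUA hUB X) convex_posSemidef
    isClosed_posSemidef fun g => ?_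
  rw [jointChannel_apply]
  exact hX.mul_mul_conjTranspose_same _

end Twirl

/-! ### The Choi correspondence -/

/-- The linear map `E` with `tr (Y E(X)) = tr ((Yᵀ ⊗ X) J)`. -/
def channelOf {a b : Type*} [Fintype a] (J : Matrix (b × a) (b × a) ℂ) : Matrix a a ℂ →ₗ[ℂ] Matrix b b ℂ where
  toFun X := Matrix.of fun k l => ∑ i, ∑ j, X i j * J (l, j) (k, i)
  map_add' X X' := by
    ext k l
    simp [add_mul, Finset.sum_add_distrib]
  map_smul' c X := by
    ext k l
    simp [Finset.mul_sum, mul_assoc]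

section ChoiMatrix

variable {a b : Type*} [Fintype a] [DecidableEq a]

/-- The operator `J` with `channelOf J = E`. -/
def choi (E : Matrix a a ℂ →ₗ[ℂ] Matrix b b ℂ) : Matrix (b × a) (b × a) ℂ :=
  Matrix.of fun p q => E (Matrix.single q.2 p.2 1) q.1 p.1

theorem channelOf_choi (E : Matrix a a ℂ →ₗ[ℂ] Matrix b b ℂ) : channelOf (choi E) = E := by
  ext X k l
  exact (linearMap_apply_eq_sum (Matrix.entryLinearMap ℂ ℂ k l ∘ₗ E) X).symm

/-- `w` is the unnormalized maximally entangled vector. Up to reordering the factors and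
transposing, the Choi operator is id ⊗ E applied to |w⟩⟨w|. -/
theorem posSemidef_choi {E : Matrix a a ℂ →ₗ[ℂ] Matrix b b ℂ} (hE : IsCompletelyPositive E) :
    (choi E).PosSemidef := by
  let e := Fintype.equivFin a
  let w : Fin (Fintype.card a) × a → ℂ := fun x => if x.1 = e x.2 then 1 else 0
  have h := ((hE _ _ (posSemidef_vecMulVec_self_star w)).submatrix
    fun q : b × a => (e q.2, q.1)).transpose
  have hw : ∀ i j : a, Matrix.single i j (1 : ℂ) =
      Matrix.of fun i' j' => vecMulVec w (star w) (e i, i') (e j, j') := fun i j => by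
    ext i' j'
    by_cases hi : i = i' <;> by_cases hj : j = j' <;>
      simp [vecMulVec_apply, w, hi, hj]
  have hchoi : choi E = ((ampliation E _ (vecMulVec w (star w))).submatrix
      (fun q : b × a => (e q.2, q.1)) fun q : b × a => (e q.2, q.1))ᵀ := by
    ext p q
    simp only [choi, of_apply, hw]
    rfl
  rwa [hchoi]

end ChoiMatrix

section Choi

variable {a b : Type*} [Fintype a] [Fintype b]

theorem trace_mul_channelOf (J : Matrix (b × a) (b × a) ℂ) (Y : Matrix b b ℂ) (X : Matrix a a ℂ) :
    (Y * channelOf J X).trace = ((Yᵀ ⊗ₖ X) * J).trace := by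
  simp only [Matrix.trace, diag_apply, Matrix.mul_apply, channelOf, LinearMap.coe_mk,
    AddHom.coe_mk, of_apply, Fintype.sum_prod_type, kroneckerMap_apply, transpose_apply,
    Finset.mul_sum]
  rw [Finset.sum_comm]
  refine Finset.sum_congr rfl fun k _ => ?_
  rw [Finset.sum_comm]
  refine Finset.sum_congr rfl fun i _ => Finset.sum_congr rfl fun l _ =>
    Finset.sum_congr rfl fun j _ => by ring

theorem isCompletelyPositive_channelOf [DecidableEq a] [DecidableEq b]
    {J : Matrix (b × a) (b × a) ℂ} (hJ : J.PosSemidef) : IsCompletelyPositive (channelOf J) := by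
  intro k M hM
  obtain ⟨B, rfl⟩ := exists_eq_conjTranspose_mul_self hJ
  -- Each row of B, reshaped to a b × a matrix, is a Kraus operator; `K r` is its ampliation.
  let K : b × a → Matrix (Fin k × b) (Fin k × a) ℂ := fun r =>
    Matrix.of fun x y => if x.1 = y.1 then B r (x.2, y.2) else 0
  have : ampliation (channelOf (Bᴴ * B)) k M = ∑ r, K r * M * (K r)ᴴ := by
    ext ⟨x, k'⟩ ⟨y, l⟩
    simp only [ampliation, channelOf, LinearMap.coe_mk, AddHom.coe_mk, of_apply, Matrix.mul_apply,
      conjTranspose_apply, K, Matrix.sum_apply, Fintype.sum_prod_type (α₁ := Fin k), ite_mul,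
      zero_mul, apply_ite star, star_zero, mul_ite, mul_zero]
    simp only [Finset.sum_ite_irrel, Finset.sum_const_zero, Finset.sum_ite_eq, Finset.mem_univ,
      if_true, Finset.mul_sum, Finset.sum_mul]
    rw [Finset.sum_comm]
    simp_rw [Finset.sum_comm (γ := b × a)]
    refine Finset.sum_congr rfl fun r _ => Finset.sum_congr rfl fun j _ =>
      Finset.sum_congr rfl fun i _ => by ring
  rw [this]
  exact posSemidef_sum _ fun r _ => hM.mul_mul_conjTranspose_same _

theorem trace_channelOf [DecidableEq b] {J : Matrix (b × a) (b × a) ℂ} (X : Matrix a a ℂ) :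
    (channelOf J X).trace = (((1 : Matrix b b ℂ) ⊗ₖ X) * J).trace := by
  have := trace_mul_channelOf J 1 X
  rwa [Matrix.one_mul, transpose_one] at this

variable [DecidableEq a]

theorem isCovariant_channelOf {G : Type*} [DecidableEq b] {UA : G → unitaryGroup a ℂ}
    {UB : G → unitaryGroup b ℂ} {J : Matrix (b × a) (b × a) ℂ}
    (hJ : ∀ g, jointChannel UB UA g J = J) : IsCovariant UA UB (channelOf J) := by
  intro g
  refine LinearMap.ext fun X => trace_mul_ext fun Y => ?_
  set U := (UB g : Matrix b b ℂ)
  have hY : unitaryChannel (UB g) (Uᴴ * Y * U) = Y := by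
    rw [unitaryChannel_apply]
    calc U * (Uᴴ * Y * U) * Uᴴ = (U * Uᴴ) * Y * (U * Uᴴ) := by simp only [Matrix.mul_assoc]
      _ = Y := by rw [unitary_mul_conjTranspose, Matrix.one_mul, Matrix.mul_one]
  rw [LinearMap.comp_apply, LinearMap.comp_apply, trace_mul_channelOf]
  conv_lhs => rw [← hY]
  rw [← jointChannel_kronecker, trace_jointChannel_mul (hJ g), ← trace_mul_channelOf,
    unitaryChannel_apply, Matrix.mul_assoc, Matrix.mul_assoc, Matrix.trace_mul_comm]
  simp only [Matrix.mul_assoc, U]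

theorem trace_jointChannel_mul_choi {G : Type*} [DecidableEq b] {UA : G → unitaryGroup a ℂ}
    {UB : G → unitaryGroup b ℂ} {E : Matrix a a ℂ →ₗ[ℂ] Matrix b b ℂ} (hE : IsCovariant UA UB E)
    (g : G) (Y : Matrix b b ℂ) (X : Matrix a a ℂ) :
    (jointChannel UB UA g (Yᵀ ⊗ₖ X) * choi E).trace = ((Yᵀ ⊗ₖ X) * choi E).trace := by
  have hcov : E (unitaryChannel (UA g) X) = unitaryChannel (UB g) (E X) :=
    LinearMap.congr_fun (hE g) X
  rw [jointChannel_kronecker, ← trace_mul_channelOf, ← trace_mul_channelOf, channelOf_choi, hcov,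
    unitaryChannel_apply, unitaryChannel_apply]
  have hu := conjTranspose_mul_unitary (UB g)
  set U := (UB g : Matrix b b ℂ)
  calc (U * Y * Uᴴ * (U * E X * Uᴴ)).trace = (U * (Y * (Uᴴ * U) * E X * Uᴴ)).trace := by
        simp only [Matrix.mul_assoc]
    _ = (Y * E X * (Uᴴ * U)).trace := by
        rw [Matrix.trace_mul_comm, hu, Matrix.mul_one, Matrix.mul_assoc, hu]
    _ = _ := by rw [hu, Matrix.mul_one]

end Choi

/-! ### Partial trace -/

section PartialTrace

variable {a b : Type*} [Fintype a] [Fintype b]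

/-- The partial trace over the first tensor factor. -/
def partialTrace (J : Matrix (b × a) (b × a) ℂ) : Matrix a a ℂ :=
  Matrix.of fun j i => ∑ k, J (k, j) (k, i)

/-- The partial trace is adjoint to X ↦ 1 ⊗ X, so tr_B J = 1 is exactly trace preservation of
`channelOf J`. -/
theorem trace_one_kronecker_mul [DecidableEq b] (X : Matrix a a ℂ) (J : Matrix (b × a) (b × a) ℂ) :
    (((1 : Matrix b b ℂ) ⊗ₖ X) * J).trace = (X * partialTrace J).trace := by
  simp only [Matrix.trace, diag_apply, Matrix.mul_apply, partialTrace, of_apply,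
    Fintype.sum_prod_type, kroneckerMap_apply, one_apply, ite_mul, one_mul, zero_mul,
    Finset.mul_sum]
  simp only [Finset.sum_ite_irrel, Finset.sum_const_zero, Finset.sum_ite_eq, Finset.mem_univ,
    if_true]
  rw [Finset.sum_comm]
  exact Finset.sum_congr rfl fun i _ => Finset.sum_comm

theorem isHermitian_partialTrace {a b : Type*} [Fintype b] {J : Matrix (b × a) (b × a) ℂ} (hJ : J.IsHermitian) :
    (partialTrace J).IsHermitian := by
  ext i j
  simp [partialTrace, ← hJ.apply (_, j) (_, i)]

theorem unitaryChannel_partialTrace {G : Type*} [DecidableEq a] [DecidableEq b]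
    {UA : G → unitaryGroup a ℂ} {UB : G → unitaryGroup b ℂ} {J : Matrix (b × a) (b × a) ℂ} {g : G}
    (hJ : jointChannel UB UA g J = J) :
    unitaryChannel (UA g) (partialTrace J) = partialTrace J := by
  refine trace_mul_ext fun X => ?_
  set U := (UA g : Matrix a a ℂ)
  have hX : unitaryChannel (UA g) (Uᴴ * X * U) = X := by
    rw [unitaryChannel_apply]
    calc U * (Uᴴ * X * U) * Uᴴ = (U * Uᴴ) * X * (U * Uᴴ) := by simp only [Matrix.mul_assoc]
      _ = X := by rw [unitary_mul_conjTranspose, Matrix.one_mul, Matrix.mul_one]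
  have h1 : unitaryChannel (UB g) (1 : Matrix b b ℂ) = 1 := by
    rw [unitaryChannel_apply, Matrix.mul_one, unitary_mul_conjTranspose]
  have h := trace_jointChannel_mul hJ ((1 : Matrix b b ℂ)ᵀ ⊗ₖ (Uᴴ * X * U))
  rw [jointChannel_kronecker, h1, hX, transpose_one, trace_one_kronecker_mul,
    trace_one_kronecker_mul] at h
  rw [h, unitaryChannel_apply]
  calc (X * (U * partialTrace J * Uᴴ)).trace = ((X * U * partialTrace J) * Uᴴ).trace := by
        simp only [Matrix.mul_assoc]
    _ = _ := by rw [Matrix.trace_mul_comm]; simp only [Matrix.mul_assoc]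

end PartialTrace

/-! ### Duality -/

theorem continuous_one_kronecker {a b : Type*} [DecidableEq b] :
    Continuous fun X : Matrix a a ℂ => (1 : Matrix b b ℂ) ⊗ₖ X :=
  continuous_matrix fun i j => continuous_const.mul (continuous_id.matrix_elem i.2 j.2)

section Lagrangian

variable {a b : Type*} [Fintype a] [Fintype b] [DecidableEq b]

/-- The Lagrangian of the min-entropy optimization problem. -/
def lagrangian (J : Matrix (b × a) (b × a) ℂ)
    (q : Matrix (b × a) (b × a) ℂ × Matrix a a ℂ) : ℝ :=
  ((q.1 - (1 : Matrix b b ℂ) ⊗ₖ q.2) * J).trace.re + q.2.trace.re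

theorem lagrangian_smul_add_smul_left {s t : ℝ} (hst : s + t = 1)
    (J J' : Matrix (b × a) (b × a) ℂ) (q : Matrix (b × a) (b × a) ℂ × Matrix a a ℂ) :
    lagrangian (s • J + t • J') q = s * lagrangian J q + t * lagrangian J' q := by
  simp only [lagrangian, Matrix.mul_add, Matrix.mul_smul, trace_add, trace_smul, Complex.add_re,
    Complex.smul_re, smul_eq_mul]
  linear_combination (-q.2.trace.re) * hst

theorem lagrangian_smul_add_smul_right (s t : ℝ) (J : Matrix (b × a) (b × a) ℂ)
    (q r : Matrix (b × a) (b × a) ℂ × Matrix a a ℂ) :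
    lagrangian J (s • q + t • r) = s * lagrangian J q + t * lagrangian J r := by
  simp only [lagrangian, Prod.fst_add, Prod.snd_add, Prod.smul_fst, Prod.smul_snd, kronecker_add,
    kronecker_smul, Matrix.sub_mul, Matrix.add_mul, Matrix.smul_mul, trace_sub, trace_add,
    trace_smul, Complex.add_re, Complex.sub_re, Complex.smul_re, smul_eq_mul]
  ring

theorem continuous_lagrangian_left (q : Matrix (b × a) (b × a) ℂ × Matrix a a ℂ) :
    Continuous fun J => lagrangian J q :=
  (Complex.continuous_re.comp (continuous_const.matrix_mul continuous_id).matrix_trace).add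
    continuous_const

theorem continuous_lagrangian_right (J : Matrix (b × a) (b × a) ℂ) :
    Continuous (lagrangian J) :=
  (Complex.continuous_re.comp ((continuous_fst.sub
    (continuous_one_kronecker.comp continuous_snd)).matrix_mul continuous_const).matrix_trace).add
    (Complex.continuous_re.comp continuous_snd.matrix_trace)

end Lagrangian

section PrimalDomain

variable {G a b : Type*} [Fintype a] [DecidableEq a] {UA : G → unitaryGroup a ℂ}

variable (UA) in
/-- Pairs of an operator in `K` and an invariant hermitian operator on `A`. -/
def primalDomain (K : Set (Matrix (b × a) (b × a) ℂ)) :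
    Set (Matrix (b × a) (b × a) ℂ × Matrix a a ℂ) :=
  K ×ˢ {X | X.IsHermitian ∧ ∀ g, unitaryChannel (UA g) X = X}

theorem convex_primalDomain {K : Set (Matrix (b × a) (b × a) ℂ)} (hK : Convex ℝ K) :
    Convex ℝ (primalDomain UA K) := by
  refine hK.prod ?_
  rintro X ⟨hX, hXi⟩ Y ⟨hY, hYi⟩ s t - - -
  refine ⟨?_, fun g => ?_⟩
  · rw [IsHermitian, conjTranspose_add, conjTranspose_smul, conjTranspose_smul, hX, hY]
    simp
  · rw [map_add, LinearMap.map_smul_of_tower, LinearMap.map_smul_of_tower, hXi, hYi]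

end PrimalDomain

section Duality

variable {G a b : Type*} [Fintype a] [DecidableEq a] [Fintype b] [DecidableEq b]
  {UB : G → unitaryGroup b ℂ} {UA : G → unitaryGroup a ℂ}

variable (UB UA) in
/-- Invariant positive semidefinite operators on `BA` with the trace of a Choi operator. -/
def dualDomain : Set (Matrix (b × a) (b × a) ℂ) :=
  {J | (J.PosSemidef ∧ J.trace = Fintype.card a) ∧ ∀ g, jointChannel UB UA g J = J}

theorem isCompact_dualDomain : IsCompact (dualDomain UB UA) := by
  refine (isCompact_posSemidef_trace_le (Fintype.card a : ℝ)).of_isClosed_subset ?_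
    fun J hJ => ⟨hJ.1.1, by simp [hJ.1.2]⟩
  have hi : IsClosed {J : Matrix (b × a) (b × a) ℂ | ∀ g, jointChannel UB UA g J = J} := by
    rw [Set.ofPred_forall]
    exact isClosed_iInter fun g => isClosed_eq
      (LinearMap.continuous_of_finiteDimensional _) continuous_id
  exact (isClosed_posSemidef.inter
    (isClosed_eq continuous_id.matrix_trace continuous_const)).inter hi

theorem convex_dualDomain : Convex ℝ (dualDomain UB UA) := by
  rintro J ⟨⟨hJ, hJt⟩, hJi⟩ J' ⟨⟨hJ', hJt'⟩, hJi'⟩ s t hs ht hst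
  refine ⟨⟨convex_posSemidef hJ hJ' hs ht hst, ?_⟩, fun g => ?_⟩
  · rw [trace_add, trace_smul, trace_smul, hJt, hJt', ← add_smul, hst, one_smul]
  · rw [map_add, LinearMap.map_smul_of_tower, LinearMap.map_smul_of_tower, hJi, hJi']

/-- In this form `X` is visibly the multiplier of the constraint tr_B J = 1. -/
theorem lagrangian_eq (J : Matrix (b × a) (b × a) ℂ)
    (q : Matrix (b × a) (b × a) ℂ × Matrix a a ℂ) :
    lagrangian J q = (q.1 * J).trace.re + (q.2 * (1 - partialTrace J)).trace.re := by
  simp only [lagrangian, Matrix.sub_mul, Matrix.mul_sub, Matrix.mul_one, trace_sub,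
    trace_one_kronecker_mul, Complex.sub_re]
  ring

theorem posSemidef_of_one_kronecker {a b : Type*} [DecidableEq b] [Nonempty b] {X : Matrix a a ℂ}
    (hX : ((1 : Matrix b b ℂ) ⊗ₖ X).PosSemidef) : X.PosSemidef := by
  obtain ⟨k⟩ := ‹Nonempty b›
  convert hX.submatrix fun i : a => (k, i) using 1
  ext i j
  simp

theorem trace_mul_vecMulVec {n : Type*} [Fintype n] (M : Matrix n n ℂ) (v : n → ℂ) :
    (M * vecMulVec v (star v)).trace = star v ⬝ᵥ M *ᵥ v := by
  rw [mul_vecMulVec, trace_vecMulVec, dotProduct_comm]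

variable [Group G] [TopologicalSpace G] [IsTopologicalGroup G] [CompactSpace G]
  [MeasurableSpace G] [BorelSpace G]

theorem trace_twirl (hUA : IsAdjointUnitaryRep UA) (hUB : IsAdjointUnitaryRep UB)
    (X : Matrix (b × a) (b × a) ℂ) : (twirl UB UA X).trace = X.trace := by
  have := trace_twirl_mul hUA hUB (X := X) (J := 1) fun g => by
    rw [Matrix.mul_one, Matrix.mul_one, jointChannel_apply, Matrix.trace_mul_comm,
      ← Matrix.mul_assoc, jointUnitary_conjTranspose_mul, Matrix.one_mul]
  simpa using this

/-- Dual feasibility: an upper bound for the Lagrangian gives a feasible point of the same value. -/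
theorem exists_feasible_of_lagrangian_le [Nonempty a] [Nonempty b]
    (hUA : IsAdjointUnitaryRep UA) (hUB : IsAdjointUnitaryRep UB)
    {S : Matrix (b × a) (b × a) ℂ} (hS : S.PosSemidef) (hSi : ∀ g, jointChannel UB UA g S = S)
    {X : Matrix a a ℂ} (hX : X.IsHermitian) (hXi : ∀ g, unitaryChannel (UA g) X = X) {c : ℝ}
    (hc : ∀ J ∈ dualDomain UB UA, lagrangian J (S, X) ≤ c) :
    ∃ Y : Matrix a a ℂ, Y.PosSemidef ∧ ((1 : Matrix b b ℂ) ⊗ₖ Y - S).PosSemidef ∧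
      Y.trace.re = c := by
  have hd : (0 : ℝ) < Fintype.card a := by exact_mod_cast Fintype.card_pos
  set d : ℝ := (Fintype.card a : ℝ) with hd_def
  -- The shift for which X + t·1 has trace exactly c.
  set t : ℝ := (c - X.trace.re) / d with ht
  set M := S - (1 : Matrix b b ℂ) ⊗ₖ X with hM
  have h1X : ((1 : Matrix b b ℂ) ⊗ₖ X).IsHermitian := by
    rw [IsHermitian, conjTranspose_kronecker, hX, conjTranspose_one]
  have hMH : M.IsHermitian := hS.isHermitian.sub h1X
  have hMi : ∀ g, jointChannel UB UA g M = M := fun g => by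
    have h1 : unitaryChannel (UB g) (1 : Matrix b b ℂ) = 1 := by
      rw [unitaryChannel_apply, Matrix.mul_one, unitary_mul_conjTranspose]
    have := jointChannel_kronecker (UB := UB) (UA := UA) g 1 X
    rw [h1, hXi, transpose_one] at this
    rw [hM, map_sub, hSi, this]
  -- The largest eigenvalue of M is at most t. Normalize |v⟩⟨v| to trace d and twirl it to obtain a
  -- test operator in the dual domain; the twirl does not change the pairing, since M is invariant.
  have hbound : ∀ v : b × a → ℂ, (star v ⬝ᵥ M *ᵥ v).re ≤ t * (star v ⬝ᵥ v).re := by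
    intro v
    rcases eq_or_ne v 0 with rfl | hv
    · simp
    have hN : 0 < star v ⬝ᵥ v := dotProduct_star_self_pos_iff.2 hv
    obtain ⟨hN0, hNim⟩ := Complex.pos_iff.1 hN
    set N : ℝ := (star v ⬝ᵥ v).re
    have hNC : star v ⬝ᵥ v = (N : ℂ) := Complex.ext rfl (by simpa using hNim.symm)
    set V : Matrix (b × a) (b × a) ℂ := ((d / N : ℝ) : ℂ) • vecMulVec v (star v)
    have hV : V.PosSemidef := (posSemidef_vecMulVec_self_star v).smul
      (Complex.zero_le_real.2 (div_nonneg hd.le hN0.le))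
    have hmem : twirl UB UA V ∈ dualDomain UB UA := by
      refine ⟨⟨posSemidef_twirl hUA hUB hV, ?_⟩, fun g => jointChannel_twirl hUA hUB g V⟩
      rw [trace_twirl hUA hUB, trace_smul, trace_vecMulVec, dotProduct_comm, hNC, smul_eq_mul,
        ← Complex.ofReal_mul, div_mul_cancel₀ _ hN0.ne', hd_def]
      simp
    have h := hc _ hmem
    have htr : (M * twirl UB UA V).trace = ((d / N : ℝ) : ℂ) * (star v ⬝ᵥ M *ᵥ v) := by
      rw [Matrix.trace_mul_comm, trace_twirl_mul hUA hUB fun g => trace_jointChannel_mul (hMi g) V,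
        Matrix.trace_mul_comm, Matrix.mul_smul, trace_smul, trace_mul_vecMulVec, smul_eq_mul]
    simp only [lagrangian] at h
    rw [← hM, htr, Complex.re_ofReal_mul] at h
    rw [ht]
    have h' : d / N * (star v ⬝ᵥ M *ᵥ v).re ≤ c - X.trace.re := by linarith
    rw [div_mul_eq_mul_div, div_le_iff₀ hN0] at h'
    rw [div_mul_eq_mul_div, le_div_iff₀ hd]
    linarith
  have hfeas : ((1 : Matrix b b ℂ) ⊗ₖ (X + (t : ℂ) • 1) - S).PosSemidef := by
    have heq : (1 : Matrix b b ℂ) ⊗ₖ (X + (t : ℂ) • 1) - S = (t : ℂ) • 1 - M := by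
      rw [kronecker_add, kronecker_smul, one_kronecker_one, hM]
      abel
    have hH : ((t : ℂ) • (1 : Matrix (b × a) (b × a) ℂ) - M).IsHermitian := by
      refine IsHermitian.sub ?_ hMH
      rw [IsHermitian, conjTranspose_smul, conjTranspose_one]
      simp
    rw [heq]
    refine PosSemidef.of_dotProduct_mulVec_nonneg hH fun v => ?_
    have him := hH.im_star_dotProduct_mulVec_self v
    refine Complex.nonneg_iff.2 ⟨?_, him.symm⟩
    have := hbound v
    rw [sub_mulVec, smul_mulVec, one_mulVec, dotProduct_sub, dotProduct_smul, smul_eq_mul,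
      Complex.sub_re, Complex.re_ofReal_mul]
    linarith
  refine ⟨X + (t : ℂ) • 1, posSemidef_of_one_kronecker (b := b) ?_, hfeas, ?_⟩
  -- 1 ⊗ Y ≥ S ≥ 0.
  · simpa using hfeas.add hS
  · rw [trace_add, trace_smul, trace_one, smul_eq_mul, Complex.add_re, Complex.re_ofReal_mul,
      Complex.natCast_re, ht, div_mul_cancel₀ _ hd.ne']
    ring

/-- Strong duality, uniformly over a convex set `K` of invariant positive semidefinite operators. -/
theorem exists_invariant_choi [Nonempty a] [Nonempty b]
    (hUA : IsAdjointUnitaryRep UA) (hUB : IsAdjointUnitaryRep UB)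
    {K : Set (Matrix (b × a) (b × a) ℂ)} (hK : Convex ℝ K) (hKne : K.Nonempty)
    (hKp : ∀ S ∈ K, S.PosSemidef) (hKi : ∀ S ∈ K, ∀ g, jointChannel UB UA g S = S) {c : ℝ}
    (hc : ∀ S ∈ K, ∀ X : Matrix a a ℂ, X.PosSemidef →
      ((1 : Matrix b b ℂ) ⊗ₖ X - S).PosSemidef → c ≤ X.trace.re) :
    ∃ J : Matrix (b × a) (b × a) ℂ, J.PosSemidef ∧ (∀ g, jointChannel UB UA g J = J) ∧
      partialTrace J = 1 ∧ ∀ S ∈ K, c ≤ (S * J).trace.re := by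
  have hne : (dualDomain UB UA).Nonempty := by
    -- The Choi operator of the completely depolarizing channel.
    refine ⟨((Fintype.card b : ℝ)⁻¹ : ℂ) • 1, ⟨PosSemidef.one.smul ?_, ?_⟩, fun g => ?_⟩
    · simp
    · rw [trace_smul, trace_one, Fintype.card_prod]
      have : (Fintype.card b : ℂ) ≠ 0 := by exact_mod_cast Fintype.card_ne_zero
      simp [this]
    · have h1 : unitaryChannel (UB g) (1 : Matrix b b ℂ) = 1 := by
        rw [unitaryChannel_apply, Matrix.mul_one, unitary_mul_conjTranspose]
      have h2 : unitaryChannel (UA g) (1 : Matrix a a ℂ) = 1 := by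
        rw [unitaryChannel_apply, Matrix.mul_one, unitary_mul_conjTranspose]
      have := jointChannel_kronecker (UB := UB) (UA := UA) g 1 1
      rw [h1, h2, transpose_one, one_kronecker_one] at this
      rw [map_smul, this]
  obtain ⟨J, hJ, hJc⟩ := exists_forall_le_of_forall_exists_le
    (isCompact_dualDomain (UB := UB) (UA := UA)) convex_dualDomain hne
    (convex_primalDomain (UA := UA) hK) lagrangian c continuous_lagrangian_left
    continuous_lagrangian_right
    (fun q _ => ⟨convex_dualDomain, fun J _ J' _ s t _ _ hst => by
      exact (lagrangian_smul_add_smul_left hst J J' q).ge⟩)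
    (fun J _ => ⟨convex_primalDomain hK, fun q _ r _ s t _ _ _ => by
      exact (lagrangian_smul_add_smul_right s t J q r).le⟩)
    (by
      rintro ⟨S, X⟩ ⟨hS, hX, hXi⟩
      obtain ⟨J, hJ, hmax⟩ := isCompact_dualDomain.exists_isMaxOn hne
        (continuous_lagrangian_left (S, X)).continuousOn
      obtain ⟨Y, hY, hYS, hYt⟩ := exists_feasible_of_lagrangian_le hUA hUB (hKp S hS) (hKi S hS)
        hX hXi hmax
      exact ⟨J, hJ, (hc S hS Y hY hYS).trans hYt.le⟩)
  obtain ⟨⟨hJp, hJt⟩, hJi⟩ := hJ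
  refine ⟨J, hJp, hJi, ?_, fun S hS => ?_⟩
  · obtain ⟨S, hS⟩ := hKne
    set H := 1 - partialTrace J with hH_def
    have hH : H.IsHermitian := isHermitian_one.sub (isHermitian_partialTrace hJp.isHermitian)
    have hHi : ∀ g, unitaryChannel (UA g) H = H := fun g => by
      rw [hH_def, map_sub, unitaryChannel_partialTrace (hJi g), unitaryChannel_apply,
        Matrix.mul_one, unitary_mul_conjTranspose]
    have hHH : 0 ≤ (Hᴴ * H).trace := (posSemidef_conjTranspose_mul_self H).trace_nonneg
    obtain ⟨hre, him⟩ := Complex.nonneg_iff.1 hHH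
    set h := (Hᴴ * H).trace.re with hh
    -- Testing against X = -s H, with H the defect 1 - tr_B J, gives a bound affine in s. It can
    -- hold for all real s only if h = tr(Hᴴ H) vanishes.
    have hle : ∀ s : ℝ, c ≤ (S * J).trace.re - s * h := fun s => by
      have := hJc (S, (-s : ℝ) • H) ⟨hS, ?_, fun g => ?_⟩
      · rw [lagrangian_eq, ← hH_def, Matrix.smul_mul, trace_smul, Complex.smul_re] at this
        rw [hh, hH]
        simpa [sub_eq_add_neg] using this
      · rw [IsHermitian, conjTranspose_smul, hH]; simp
      · rw [LinearMap.map_smul_of_tower, hHi]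
    have h0 : h = 0 := by
      by_contra hne0
      have := hle (((S * J).trace.re - c + 1) / h)
      rw [div_mul_cancel₀ _ hne0] at this
      linarith
    have : H = 0 := trace_conjTranspose_mul_self_eq_zero_iff.1 (Complex.ext h0 him.symm)
    exact (sub_eq_zero.1 this).symm
  · have := hJc (S, 0) ⟨hS, isHermitian_zero, fun g => map_zero _⟩
    rw [lagrangian_eq] at this
    simpa using this

end Duality

/-! ### The operators `Σ^p` -/

theorem IsPureState.isState {n : Type*} [Fintype n] {ψ : Matrix n n ℂ} (hψ : IsPureState ψ) :
    IsState ψ := by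
  obtain ⟨v, hv, rfl⟩ := hψ
  exact ⟨posSemidef_vecMulVec_self_star v, by rw [trace_vecMulVec, dotProduct_comm, hv]⟩

theorem IsPureState.fidelity_eq {n : Type*} [Fintype n] [DecidableEq n] {ψ σ : Matrix n n ℂ}
    (hψ : IsPureState ψ) (hσ : σ.PosSemidef) : fidelity σ ψ = (ψ * σ).trace.re := by
  obtain ⟨v, -, rfl⟩ := hψ
  exact fidelity_vecMulVec hσ v

theorem IsState.norm_apply_le {n : Type*} [Fintype n] [DecidableEq n] {ρ : Matrix n n ℂ}
    (hρ : IsState ρ) (i j : n) : ‖ρ i j‖ ≤ 1 := by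
  simpa [hρ.2] using norm_apply_le_trace hρ.1 i j

theorem IsState.nonempty {n : Type*} [Fintype n] {ρ : Matrix n n ℂ} (hρ : IsState ρ) :
    Nonempty n := by
  by_contra h
  rw [not_nonempty_iff] at h
  simpa [Matrix.trace] using hρ.2

theorem IsCompletelyPositive.posSemidef_apply {a b : Type*} {E : Matrix a a ℂ →ₗ[ℂ] Matrix b b ℂ}
    (hE : IsCompletelyPositive E) {X : Matrix a a ℂ} (hX : X.PosSemidef) : (E X).PosSemidef :=
  (hE 1 _ (hX.submatrix Prod.snd)).submatrix fun k => (0, k)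

section Sigma

variable {G Λ a b : Type*} [Group G] [TopologicalSpace G] [IsTopologicalGroup G] [CompactSpace G]
  [MeasurableSpace G] [BorelSpace G] [MeasurableSpace Λ]
  [Fintype a] [DecidableEq a] [Fintype b] [DecidableEq b]
  {UA : G → unitaryGroup a ℂ} {UB : G → unitaryGroup b ℂ}
  {ρ : Λ → Matrix a a ℂ} {ψ : Λ → Matrix b b ℂ}

/-- The twirl is linear, so it suffices that the average of ψᵀ ⊗ ρ lies in the preimage of `C`,
again closed and convex; no interchange of integrals is needed. -/
theorem sigmaState_mem (hUA : IsAdjointUnitaryRep UA) (hUB : IsAdjointUnitaryRep UB)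
    (hρ : ∀ μ, IsState (ρ μ)) (hψ : ∀ μ, IsState (ψ μ))
    (hρm : ∀ i j, Measurable fun μ => ρ μ i j) (hψm : ∀ i j, Measurable fun μ => ψ μ i j)
    {C : Set (Matrix (b × a) (b × a) ℂ)} (hC : Convex ℝ C) (hCc : IsClosed C)
    (hmem : ∀ μ, twirl UB UA ((ψ μ)ᵀ ⊗ₖ ρ μ) ∈ C) (p : ProbabilityMeasure Λ) :
    sigmaState UB UA ψ ρ p ∈ C := by
  have hint : ∀ i j, Integrable (fun μ => ((ψ μ)ᵀ ⊗ₖ ρ μ) i j) (p : Measure Λ) := fun i j => by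
    refine Integrable.of_bound (C := 1)
      ((hψm j.1 i.1).mul (hρm i.2 j.2)).aestronglyMeasurable (ae_of_all _ fun μ => ?_)
    rw [kroneckerMap_apply, transpose_apply, norm_mul]
    exact mul_le_one₀ ((hψ μ).norm_apply_le _ _) (norm_nonneg _) ((hρ μ).norm_apply_le _ _)
  exact entryIntegral_mem hint
    (hC.linear_preimage ((twirlLinear hUA hUB).restrictScalars ℝ))
    (hCc.preimage (LinearMap.continuous_of_finiteDimensional (twirlLinear hUA hUB))) hmem

/-- A finitely supported probability measure. -/
def finiteMixture {ι : Type*} [Fintype ι] (w : ι → ℝ) (x : ι → Λ) : Measure Λ :=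
  ∑ i, ENNReal.ofReal (w i) • Measure.dirac (x i)

theorem isProbabilityMeasure_finiteMixture {ι : Type*} [Fintype ι] {w : ι → ℝ} (hw : ∀ i, 0 ≤ w i)
    (hw1 : ∑ i, w i = 1) (x : ι → Λ) : IsProbabilityMeasure (finiteMixture w x) := by
  constructor
  simp [finiteMixture, ← ENNReal.ofReal_sum_of_nonneg fun i _ => hw i, hw1]

theorem integral_finiteMixture {ι : Type*} [Fintype ι] {w : ι → ℝ} (hw : ∀ i, 0 ≤ w i)
    (x : ι → Λ) {f : Λ → ℂ} (hf : Measurable f) :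
    ∫ μ, f μ ∂(finiteMixture w x) = ∑ i, w i • f (x i) := by
  rw [finiteMixture, integral_finsetSum_measure]
  · refine Finset.sum_congr rfl fun i _ => ?_
    -- Measurability of f replaces measurability of points, which may fail since Λ need not be
    -- separated.
    rw [integral_smul_measure, integral_dirac' _ _ hf.stronglyMeasurable,
      ENNReal.toReal_ofReal (hw i)]
  · intro i _
    exact (integrable_dirac' hf.stronglyMeasurable (by simp)).smul_measure ENNReal.ofReal_ne_top

theorem exists_sigmaState_eq (hUA : IsAdjointUnitaryRep UA) (hUB : IsAdjointUnitaryRep UB)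
    (hρm : ∀ i j, Measurable fun μ => ρ μ i j) (hψm : ∀ i j, Measurable fun μ => ψ μ i j)
    {S : Matrix (b × a) (b × a) ℂ}
    (hS : S ∈ convexHull ℝ (Set.range fun μ => twirl UB UA ((ψ μ)ᵀ ⊗ₖ ρ μ))) :
    ∃ p : ProbabilityMeasure Λ, sigmaState UB UA ψ ρ p = S := by
  obtain ⟨ι, _, w, z, hw, hw1, hz, rfl⟩ := mem_convexHull_iff_exists_fintype.1 hS
  choose x hx using hz
  refine ⟨⟨finiteMixture w x, isProbabilityMeasure_finiteMixture hw hw1 x⟩, ?_⟩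
  have havg : averagedState ⟨finiteMixture w x, isProbabilityMeasure_finiteMixture hw hw1 x⟩ ψ ρ =
      ∑ i, w i • ((ψ (x i))ᵀ ⊗ₖ ρ (x i)) := by
    ext i j
    rw [Matrix.sum_apply]
    exact integral_finiteMixture hw x ((hψm j.1 i.1).mul (hρm i.2 j.2))
  change twirlLinear hUA hUB (averagedState _ ψ ρ) = _
  rw [havg, map_sum]
  refine Finset.sum_congr rfl fun i _ => ?_
  rw [LinearMap.map_smul_of_tower]
  exact congrArg (w i • ·) (hx i)

/-- Weak duality: the performance of a covariant channel bounds the min-entropy. -/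
theorem le_trace_of_channel (hUA : IsAdjointUnitaryRep UA) (hUB : IsAdjointUnitaryRep UB)
    (hρ : ∀ μ, IsState (ρ μ)) (hψ : ∀ μ, IsState (ψ μ))
    (hρm : ∀ i j, Measurable fun μ => ρ μ i j) (hψm : ∀ i j, Measurable fun μ => ψ μ i j)
    {E : Matrix a a ℂ →ₗ[ℂ] Matrix b b ℂ} (hE : IsChannel E) (hcov : IsCovariant UA UB E) {c : ℝ}
    (hc : ∀ μ, c ≤ (ψ μ * E (ρ μ)).trace.re) (p : ProbabilityMeasure Λ) {X : Matrix a a ℂ}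
    (hX : ((1 : Matrix b b ℂ) ⊗ₖ X - sigmaState UB UA ψ ρ p).PosSemidef) : c ≤ X.trace.re := by
  have hJ := posSemidef_choi hE.completelyPositive
  have h1 : c ≤ (sigmaState UB UA ψ ρ p * choi E).trace.re := by
    -- The half-space of S with tr(S J) ≥ c contains every T_μ, hence every average.
    refine sigmaState_mem hUA hUB hρ hψ hρm hψm
      (C := {S | c ≤ (S * choi E).trace.re}) ?_ ?_ (fun μ => ?_) p
    · intro S hS T hT s t hs ht hst
      simp only [Set.mem_ofPred_eq, Matrix.add_mul, Matrix.smul_mul, trace_add, trace_smul,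
        Complex.add_re, Complex.smul_re, smul_eq_mul] at hS hT ⊢
      calc c = s * c + t * c := by rw [← add_mul, hst, one_mul]
        _ ≤ _ := add_le_add (mul_le_mul_of_nonneg_left hS hs) (mul_le_mul_of_nonneg_left hT ht)
    · exact isClosed_le continuous_const
        (Complex.continuous_re.comp (continuous_id.matrix_mul continuous_const).matrix_trace)
    · change c ≤ _
      rw [trace_twirl_mul hUA hUB fun g => trace_jointChannel_mul_choi hcov g _ _,
        ← trace_mul_channelOf, channelOf_choi]
      exact hc μ
  have h2 := trace_mul_re_nonneg hX hJ
  rw [Matrix.sub_mul, trace_sub, ← trace_channelOf, channelOf_choi, hE.tracePreserving,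
    Complex.sub_re] at h2
  linarith

/-- Strong duality: a bound on all min-entropies is met by a single covariant channel. -/
theorem exists_channel_of_le_trace [Nonempty Λ]
    (hUA : IsAdjointUnitaryRep UA) (hUB : IsAdjointUnitaryRep UB)
    (hρ : ∀ μ, IsState (ρ μ)) (hψ : ∀ μ, IsState (ψ μ))
    (hρm : ∀ i j, Measurable fun μ => ρ μ i j) (hψm : ∀ i j, Measurable fun μ => ψ μ i j) {c : ℝ}
    (hc : ∀ (p : ProbabilityMeasure Λ) (X : Matrix a a ℂ), X.PosSemidef →
      ((1 : Matrix b b ℂ) ⊗ₖ X - sigmaState UB UA ψ ρ p).PosSemidef → c ≤ X.trace.re) :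
    ∃ E : Matrix a a ℂ →ₗ[ℂ] Matrix b b ℂ, IsChannel E ∧ IsCovariant UA UB E ∧
      ∀ μ, c ≤ (ψ μ * E (ρ μ)).trace.re := by
  obtain ⟨μ₀⟩ := ‹Nonempty Λ›
  have := (hρ μ₀).nonempty
  have := (hψ μ₀).nonempty
  let T : Λ → Matrix (b × a) (b × a) ℂ := fun μ => twirl UB UA ((ψ μ)ᵀ ⊗ₖ ρ μ)
  have hTp : convexHull ℝ (Set.range T) ⊆ {S | S.PosSemidef} :=
    convexHull_min (by
      rintro _ ⟨μ, rfl⟩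
      exact posSemidef_twirl hUA hUB ((hψ μ).1.transpose.kronecker (hρ μ).1)) convex_posSemidef
  have hTi : convexHull ℝ (Set.range T) ⊆ {S | ∀ g, jointChannel UB UA g S = S} := by
    refine convexHull_min ?_ fun S hS S' hS' s t _ _ _ g => ?_
    · rintro _ ⟨μ, rfl⟩
      exact fun g => jointChannel_twirl hUA hUB g _
    · rw [map_add, LinearMap.map_smul_of_tower, LinearMap.map_smul_of_tower, hS g, hS' g]
  -- The hull need not be closed here: minimax uses compactness only on the side of `J`, and hull
  -- points come from finitely supported p.
  obtain ⟨J, hJp, hJi, hJ1, hJc⟩ := exists_invariant_choi hUA hUB (convex_convexHull ℝ (Set.range T))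
    ⟨T μ₀, subset_convexHull ℝ _ ⟨μ₀, rfl⟩⟩ hTp hTi (c := c) (by
      intro S hS
      obtain ⟨p, rfl⟩ := exists_sigmaState_eq hUA hUB hρm hψm hS
      exact hc p)
  refine ⟨channelOf J, ⟨isCompletelyPositive_channelOf hJp, fun X => ?_⟩,
    isCovariant_channelOf hJi, fun μ => ?_⟩
  · rw [trace_channelOf, trace_one_kronecker_mul, hJ1, Matrix.mul_one]
  · have h := hJc (T μ) (subset_convexHull ℝ _ ⟨μ, rfl⟩)
    rwa [trace_twirl_mul hUA hUB fun g => trace_jointChannel_mul (hJi g) _,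
      ← trace_mul_channelOf] at h

/-- For continuous families, the largest min-entropy is attained. -/
theorem exists_forall_condMinEntropy_le [TopologicalSpace Λ] [CompactSpace Λ] [Nonempty Λ]
    (hUA : IsAdjointUnitaryRep UA) (hUB : IsAdjointUnitaryRep UB)
    (hρ : ∀ μ, IsState (ρ μ)) (hψ : ∀ μ, IsState (ψ μ))
    (hρm : ∀ i j, Measurable fun μ => ρ μ i j) (hψm : ∀ i j, Measurable fun μ => ψ μ i j)
    (hρc : Continuous ρ) (hψc : Continuous ψ) :
    ∃ p₀ : ProbabilityMeasure Λ, ∀ p : ProbabilityMeasure Λ,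
      condMinEntropy (sigmaState UB UA ψ ρ p) ≤ condMinEntropy (sigmaState UB UA ψ ρ p₀) := by
  let T : Λ → Matrix (b × a) (b × a) ℂ := fun μ => twirl UB UA ((ψ μ)ᵀ ⊗ₖ ρ μ)
  have hT : Continuous T := by
    refine (LinearMap.continuous_of_finiteDimensional (twirlLinear hUA hUB)).comp
      (continuous_matrix fun i j => ?_)
    exact (hψc.matrix_elem j.1 i.1).mul (hρc.matrix_elem i.2 j.2)
  have hK : IsCompact (convexHull ℝ (Set.range T)) := isCompact_convexHull (isCompact_range hT)
  have hmem : ∀ p, sigmaState UB UA ψ ρ p ∈ convexHull ℝ (Set.range T) :=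
    sigmaState_mem hUA hUB hρ hψ hρm hψm (convex_convexHull ℝ _) hK.isClosed
      fun μ => subset_convexHull ℝ _ ⟨μ, rfl⟩
  -- Feasible pairs, with the trace cut off at R to make them compact; operators of trace above R
  -- cannot beat the minimizer.
  let F : ℝ → Set (Matrix (b × a) (b × a) ℂ × Matrix a a ℂ) := fun R =>
    (convexHull ℝ (Set.range T) ×ˢ {X | X.PosSemidef ∧ X.trace.re ≤ R}) ∩
      {q | ((1 : Matrix b b ℂ) ⊗ₖ q.2 - q.1).PosSemidef}
  have hF : ∀ R, IsCompact (F R) := fun R =>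
    (hK.prod (isCompact_posSemidef_trace_le R)).inter_right (isClosed_posSemidef.preimage
      ((continuous_one_kronecker.comp continuous_snd).sub continuous_fst))
  by_cases hex : ∃ R, (F R).Nonempty
  · obtain ⟨R, hR⟩ := hex
    have hcont : Continuous fun q : Matrix (b × a) (b × a) ℂ × Matrix a a ℂ => q.2.trace.re :=
      Complex.continuous_re.comp continuous_snd.matrix_trace
    obtain ⟨⟨S, X⟩, ⟨⟨hS, hX, hXR⟩, hSX⟩, hmin⟩ := (hF R).exists_isMinOn hR hcont.continuousOn
    obtain ⟨p₀, rfl⟩ := exists_sigmaState_eq hUA hUB hρm hψm hS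
    refine ⟨p₀, fun p => condMinEntropy_mono fun Y hY hYS => ⟨X, hX, hSX, ?_⟩⟩
    rcases le_total Y.trace.re R with h | h
    · have hYF : (sigmaState UB UA ψ ρ p, Y) ∈ F R := ⟨⟨hmem p, hY, h⟩, hYS⟩
      exact isMinOn_iff.1 hmin _ hYF
    · exact hXR.trans h
  -- With no feasible pair at all, any p₀ works vacuously.
  · obtain ⟨μ₀⟩ := ‹Nonempty Λ›
    let p₀ : ProbabilityMeasure Λ := ⟨Measure.dirac μ₀, inferInstance⟩
    exact ⟨p₀, fun p => condMinEntropy_mono fun Y hY hYS =>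
      (hex ⟨Y.trace.re, (_, Y), ⟨hmem p, hY, le_rfl⟩, hYS⟩).elim⟩

end Sigma

end Asymmetry

end

theorem lemma1 {G Λ a b : Type*}
    [Group G] [TopologicalSpace G] [IsTopologicalGroup G] [CompactSpace G]
    [MeasurableSpace G] [BorelSpace G]
    [TopologicalSpace Λ] [CompactSpace Λ] [Nonempty Λ] [MeasurableSpace Λ] [BorelSpace Λ]
    [Fintype a] [DecidableEq a] [Fintype b] [DecidableEq b]
    (UA : G → unitaryGroup a ℂ) (UB : G → unitaryGroup b ℂ)
    (hUA : Asymmetry.IsAdjointUnitaryRep UA) (hUB : Asymmetry.IsAdjointUnitaryRep UB)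
    (ρ : Λ → Matrix a a ℂ) (ψ : Λ → Matrix b b ℂ)
    (hρ : ∀ μ, Asymmetry.IsState (ρ μ)) (hψ : ∀ μ, Asymmetry.IsPureState (ψ μ))
    (hρm : ∀ i j, Measurable fun μ => ρ μ i j) (hψm : ∀ i j, Measurable fun μ => ψ μ i j) :
    (∀ ε : ℝ, 0 ≤ ε → ε ≤ 1 →
      ((∃ E : Matrix a a ℂ →ₗ[ℂ] Matrix b b ℂ, Asymmetry.IsChannel E ∧
          Asymmetry.IsCovariant UA UB E ∧
          ∀ μ, 1 - ε ≤ Asymmetry.fidelity (E (ρ μ)) (ψ μ)) ↔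
        (⨆ p : ProbabilityMeasure Λ,
            Asymmetry.condMinEntropy (Asymmetry.sigmaState UB UA ψ ρ p)) ≤
          Asymmetry.log2 (1 / ENNReal.ofReal (1 - ε)))) ∧
    (Continuous ρ → Continuous ψ →
      ∃ p₀ : ProbabilityMeasure Λ,
        Asymmetry.condMinEntropy (Asymmetry.sigmaState UB UA ψ ρ p₀) =
          (⨆ p : ProbabilityMeasure Λ,
            Asymmetry.condMinEntropy (Asymmetry.sigmaState UB UA ψ ρ p))) := by
  have hψ' : ∀ μ, Asymmetry.IsState (ψ μ) := fun μ => (hψ μ).isState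
  have hfid : ∀ E : Matrix a a ℂ →ₗ[ℂ] Matrix b b ℂ, Asymmetry.IsChannel E → ∀ μ,
      Asymmetry.fidelity (E (ρ μ)) (ψ μ) = (ψ μ * E (ρ μ)).trace.re := fun E hE μ =>
    (hψ μ).fidelity_eq (hE.completelyPositive.posSemidef_apply (hρ μ).1)
  refine ⟨fun ε _ _ => ⟨?_, fun h => ?_⟩, fun hρc hψc => ?_⟩
  · rintro ⟨E, hE, hcov, hF⟩
    refine iSup_le fun p => Asymmetry.condMinEntropy_le_iff.2 fun X _ hX => ?_
    exact Asymmetry.le_trace_of_channel hUA hUB hρ hψ' hρm hψm hE hcov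
      (fun μ => (hF μ).trans_eq (hfid E hE μ)) p hX
  · obtain ⟨E, hE, hcov, hF⟩ := Asymmetry.exists_channel_of_le_trace hUA hUB hρ hψ' hρm hψm
      fun p => Asymmetry.condMinEntropy_le_iff.1 ((le_iSup _ p).trans h)
    exact ⟨E, hE, hcov, fun μ => (hF μ).trans_eq (hfid E hE μ).symm⟩
  · obtain ⟨p₀, hp₀⟩ := Asymmetry.exists_forall_condMinEntropy_le hUA hUB hρ hψ' hρm hψm hρc hψc
    exact ⟨p₀, le_antisymm (le_iSup (fun p => Asymmetry.condMinEntropy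
      (Asymmetry.sigmaState UB UA ψ ρ p)) p₀) (iSup_le hp₀)⟩
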